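/- Conventions. A relation symbol has an arity at least $1$; an instance is a finite set of facts $R(a_1,\dots,a_m)$. A tuple-generating dependency (TGD) is a sentence $\rho=\forall\bar x\forall\bar y\,(\varphi(\bar x,\bar y)\to\exists\bar z\,\psi(\bar x,\bar z))$ with $\varphi$ (the body) and $\psi$ (the head) finite, possibly empty ($\top$), conjunctions of relational atoms without constants; the frontier variables $\bar x$ are those that occur in both the body and the head. An instance $I$ satisfies $\rho$ if every match of the body in $I$ agrees on the frontier variables with some match of the head in $I$. The TGD $\rho$ is full if every variable of the head occurs in the body, guarded (GTGD) if the body is empty or has an atom that mentions all variables of the body, frontier-guarded (FGTGD) if the body is empty or has an atom that mentions all frontier variables, and frontier-one (F1TGD) if it has at most one frontier variable. An ontology is a finite set of TGDs, and it is satisfied by $I$ if all its members are; for a class $\mathcal L$ of TGDs, an $\mathcal L$-ontology is one whose members all belong to $\mathcal L$. A fitting instance is a pair $(\mathsf P,\mathsf N)$ of non-empty finite sets of instances. A TGD or ontology fits $(\mathsf P,\mathsf N)$ if it uses only relation symbols that occur in $\mathsf P\cup\mathsf N$, is satisfied by every $I\in\mathsf P$, and is not satisfied by any $J\in\mathsf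 N$. The size $\|O\|$ of a syntactic object $O$ is the length of its encoding as a word over a finite alphabet, with names of relation symbols, values and variables written in binary. Theorem. (1) There is a polynomial $p$ such that for every $n\ge 1$ there is a fitting instance $(\mathsf P_n,\mathsf N_n)$ with $\|(\mathsf P_n,\mathsf N_n)\|\le p(n)$ such that some TGD that is both guarded and frontier-one fits $(\mathsf P_n,\mathsf N_n)$, while every TGD that fits $(\mathsf P_n,\mathsf N_n)$ has size at least $2^n$; moreover, some ontology consisting of TGDs that are both guarded and frontier-one fits $(\mathsf P_n,\mathsf N_n)$, while every ontology that fits $(\mathsf P_n,\mathsf N_n)$ has size at least $2^n$. (2) These bounds are tight for GTGD, FGTGD and F1TGD: for each $\mathcal L\in\{\text{GTGD},\text{FGTGD},\text{F1TGD}\}$ there is a polynomial $q$ such that, for every fitting instance $(\mathsf P,\mathsf N)$, if some $\mathcal L$-TGD fits $(\mathsf P,\mathsf N)$, then some $\mathcal L$-TGD of size at most $2^{q(\|(\mathsf P,\mathsf N)\|)}$ fits $(\mathsf P,\mathsf N)$, and if some $\mathcal L$-ontology fits $(\mathsf P,\mathsf N)$, then some $\mathcal L$-ontology of size at most $2^{q(\|(\mathsf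 P,\mathsf N)\|)}$ fits $(\mathsf P,\mathsf N)$. (3) There is a polynomial $p$ such that for every $n\ge 1$ there is a fitting instance $(\mathsf P_n,\mathsf N_n)$ with $\|(\mathsf P_n,\mathsf N_n)\|\le p(n)$ such that some full TGD fits $(\mathsf P_n,\mathsf N_n)$, while every full TGD that fits $(\mathsf P_n,\mathsf N_n)$ has size at least $2^n$. -/

import Mathlib

namespace TGDFitting

/-- A relation symbol: a name together with an arity `≥ 1`. -/
structure RelSym where
  name : ℕ
  arity : ℕ
  arity_pos : 1 ≤ arity

/-- An expression `R(t₁, …, tₘ)` with `m` the arity of `R`. It is a fact when the `tᵢ` are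
values and a relational atom when the `tᵢ` are variables. -/
structure Atom (α : Type) where
  rel : RelSym
  args : Fin rel.arity → α

namespace Atom

/-- Component-wise application of a map to the arguments. -/
def map {α β : Type} (h : α → β) (a : Atom α) : Atom β :=
  ⟨a.rel, fun i => h (a.args i)⟩

/-- The set of arguments that are mentioned. -/
def terms {α : Type} (a : Atom α) : Set α := Set.range a.args

/-- Length of the encoding as a word: one letter that starts the atom, the name of the relation
symbol in binary, and for every argument position a comma and the argument in binary. -/
def size (a : Atom ℕ) : ℕ :=
  1 + Nat.size a.rel.name + ∑ i, (1 + Nat.size (a.args i))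

end Atom

/-- The set of arguments that occur in a finite set (conjunction) of atoms. -/
def occurring (s : Finset (Atom ℕ)) : Set ℕ := {x | ∃ a ∈ s, x ∈ a.terms}

/-- A finite instance: a finite set of facts. Values are natural numbers. -/
abbrev Inst : Type := Finset (Atom ℕ)

/-- Size of a finite instance (a separator, followed by its facts). -/
def Inst.size (I : Inst) : ℕ := 1 + ∑ a ∈ I, a.size

/-- The tuple-generating dependency `∀x̄ ∀ȳ (φ(x̄,ȳ) → ∃z̄ ψ(x̄,z̄))`, where `body` is the set of
conjuncts of `φ` and `head` is the set of conjuncts of `ψ`. Variables are natural numbers. The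
empty conjunction is `⊤`. -/
structure TGD where
  body : Finset (Atom ℕ)
  head : Finset (Atom ℕ)

namespace TGD

/-- The frontier variables: those that occur both in the body and in the head. -/
def frontier (ρ : TGD) : Set ℕ := occurring ρ.body ∩ occurring ρ.head

/-- `I ⊨ ρ`: every match of the body in `I` agrees on the frontier variables with a match of the
head in `I`. -/
def Holds (I : Inst) (ρ : TGD) : Prop :=
  ∀ h : ℕ → ℕ, (∀ a ∈ ρ.body, a.map h ∈ I) →
    ∃ g : ℕ → ℕ, (∀ x ∈ ρ.frontier, g x = h x) ∧ ∀ a ∈ ρ.head, a.map g ∈ I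

/-- All relation symbols of `ρ` belong to `S`. -/
def Over (S : Set RelSym) (ρ : TGD) : Prop :=
  (∀ a ∈ ρ.body, a.rel ∈ S) ∧ ∀ a ∈ ρ.head, a.rel ∈ S

/-- Full: no existentially quantified variables in the head. -/
def IsFull (ρ : TGD) : Prop := occurring ρ.head ⊆ occurring ρ.body

/-- Guarded: some body atom mentions all variables of the body (the body `⊤`, which has no
variables, counts as guarded). -/
def IsGuarded (ρ : TGD) : Prop :=
  ρ.body = ∅ ∨ ∃ a ∈ ρ.body, occurring ρ.body ⊆ a.terms

/-- Frontier-guarded: some body atom mentions all frontier variables (the body `⊤` counts as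
frontier-guarded). -/
def IsFrontierGuarded (ρ : TGD) : Prop :=
  ρ.body = ∅ ∨ ∃ a ∈ ρ.body, ρ.frontier ⊆ a.terms

/-- Frontier-one: at most one frontier variable. -/
def IsFrontierOne (ρ : TGD) : Prop := ρ.frontier.Subsingleton

/-- Size of a TGD (the body atoms, an arrow, the head atoms). -/
def size (ρ : TGD) : ℕ := ∑ a ∈ ρ.body, a.size + 1 + ∑ a ∈ ρ.head, a.size

end TGD

/-- An ontology: a finite set of TGDs. -/
abbrev Ontology : Type := Finset TGD

namespace Ontology

/-- `I` is a model of the ontology. -/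
def Holds (I : Inst) (O : Ontology) : Prop := ∀ ρ ∈ O, TGD.Holds I ρ

/-- All relation symbols of the ontology belong to `S`. -/
def Over (S : Set RelSym) (O : Ontology) : Prop := ∀ ρ ∈ O, TGD.Over S ρ

/-- Size of an ontology (every TGD is preceded by a separator). -/
def size (O : Ontology) : ℕ := ∑ ρ ∈ O, (1 + ρ.size)

end Ontology

/-- A fitting instance: non-empty finite sets of positive and of negative examples, each of which
is a finite instance. -/
structure FittingInstance where
  pos : Finset Inst
  neg : Finset Inst
  pos_nonempty : pos.Nonempty
  neg_nonempty : neg.Nonempty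

namespace FittingInstance

/-- The set of relation symbols used in the examples. -/
def schema (E : FittingInstance) : Set RelSym :=
  {R | ∃ I : Inst, (I ∈ E.pos ∨ I ∈ E.neg) ∧ ∃ a ∈ I, a.rel = R}

/-- Size of a fitting instance (the positive examples, a separator, the negative examples). -/
def size (E : FittingInstance) : ℕ :=
  ∑ I ∈ E.pos, Inst.size I + 1 + ∑ I ∈ E.neg, Inst.size I

/-- The TGD `ρ` fits `E`. -/
def FitTGD (E : FittingInstance) (ρ : TGD) : Prop :=
  ρ.Over E.schema ∧ (∀ I ∈ E.pos, TGD.Holds I ρ) ∧ ∀ J ∈ E.neg, ¬ TGD.Holds J ρ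

/-- The ontology `O` fits `E`. -/
def FitOntology (E : FittingInstance) (O : Ontology) : Prop :=
  Ontology.Over E.schema O ∧ (∀ I ∈ E.pos, Ontology.Holds I O) ∧
    ∀ J ∈ E.neg, ¬ Ontology.Holds J O

end FittingInstance

end TGDFitting

open TGDFitting

/-!
Upper bounds. Guarded and frontier-one TGDs are frontier-guarded, and all three classes are closed
under substitutions that do not merge existentially quantified variables with body variables. If a
TGD fails in some negative examples, fix a match of the body that witnesses each failure; body
variables that all these matches send to the same value may be identified. This embeds the body into
the direct product of the negative examples. If a frontier-guarded TGD holds in a positive example,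
then the restriction of a body match to the frontier is determined by the image of the guard, so
there are only as many head matches to provide as there are facts; existentially quantified
variables on which all of the chosen head matches agree may be identified, too. What remains is a
TGD with `2 ^ poly` variables over a schema of polynomial arity (`TGD.exists_rename_lt`), and there
are only `2 ^ poly` atoms over so many variables (`sum_size_le`). For an ontology, one such TGD for
every negative example suffices.

Lower bounds. Both constructions speak about directed walks from a start point to an end point. A
cycle of length `k` with one start point and its predecessor as the end point has exactly the
walks of length `-1` modulo `k`, so a conjunction that contains a walk and can be matched into the
cycles of all lengths `k ≤ 2 * n` has a walk whose length plus one is a multiple of `2, …, 2 * n`,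
hence of the central binomial coefficient, and is at least `2 ^ n` (`two_pow_le_of_forall_dvd`). As
a shortest walk repeats no edge, the conjunction is exponentially large (`le_sum_size_of_isWalk`). A
conjunction without walks can be matched into a fixed instance, since the points reachable from a
start point can be separated from the end points (`exists_closed_of_no_walk`).

For arbitrary TGDs and ontologies this fixed instance, the trap, is the negative example, and the
positive examples are its disjoint unions with the cycles. The trap is part of every positive
example, so the only way to fail in it is a head that contains a walk. For full TGDs the cycles are
the negative examples, and the positive example is a variant of the trap, the blocker, which can
falsify any atom not listed in the body; so the only way to hold in it nontrivially is a body that contains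
a walk.
-/

namespace TGDFitting

/-! ### Renaming variables -/

noncomputable instance : DecidableEq (Atom ℕ) := Classical.decEq _

noncomputable instance : DecidableEq RelSym := Classical.decEq _

noncomputable instance : DecidableEq TGD := Classical.decEq _

theorem Atom.map_map {α β γ : Type} (g : β → γ) (h : α → β) (a : Atom α) :
    (a.map h).map g = a.map (g ∘ h) := rfl

theorem Atom.map_congr {α β : Type} {g h : α → β} {a : Atom α} (H : ∀ x ∈ a.terms, g x = h x) :
    a.map g = a.map h := by
  unfold Atom.map
  congr 1
  funext i
  exact H _ ⟨i, rfl⟩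

theorem Atom.eqOn_of_map_eq {α β : Type} {g h : α → β} {a : Atom α} (H : a.map g = a.map h) :
    ∀ x ∈ a.terms, g x = h x := by
  rintro _ ⟨i, rfl⟩
  unfold Atom.map at H
  simp only [Atom.mk.injEq, heq_eq_eq, true_and] at H
  exact congrFun H i

theorem Atom.terms_map {α β : Type} (h : α → β) (a : Atom α) : (a.map h).terms = h '' a.terms :=
  Set.range_comp h a.args

theorem occurring_image_map (σ : ℕ → ℕ) (s : Finset (Atom ℕ)) :
    occurring (s.image (Atom.map σ)) = σ '' occurring s := by
  ext v
  constructor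
  · rintro ⟨b, hb, hv⟩
    obtain ⟨a, ha, rfl⟩ := Finset.mem_image.1 hb
    rw [Atom.terms_map] at hv
    obtain ⟨x, hx, rfl⟩ := hv
    exact ⟨x, ⟨a, ha, hx⟩, rfl⟩
  · rintro ⟨x, ⟨a, ha, hx⟩, rfl⟩
    exact ⟨a.map σ, Finset.mem_image_of_mem _ ha, by
      rw [Atom.terms_map]; exact Set.mem_image_of_mem _ hx⟩

theorem mem_occurring_of_match {s : Finset (Atom ℕ)} {I : Inst} {h : ℕ → ℕ}
    (H : ∀ a ∈ s, a.map h ∈ I) {x : ℕ} (hx : x ∈ occurring s) : h x ∈ occurring I := by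
  obtain ⟨a, ha, hxa⟩ := hx
  exact ⟨a.map h, H a ha, by rw [Atom.terms_map]; exact Set.mem_image_of_mem _ hxa⟩

/-- A map that identifies only points of `X` at which `F` agrees is a factor of `F` on `X`. -/
theorem exists_factor {σ F : ℕ → ℕ} {X : Set ℕ}
    (H : ∀ x ∈ X, ∀ y ∈ X, σ x = σ y → F x = F y) : ∃ g : ℕ → ℕ, ∀ x ∈ X, g (σ x) = F x := by
  classical
  refine ⟨fun v => if hv : ∃ x ∈ X, σ x = v then F hv.choose else 0, fun x hx => ?_⟩
  have hv : ∃ y ∈ X, σ y = σ x := ⟨x, hx, rfl⟩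
  simp only [dif_pos hv]
  exact H _ hv.choose_spec.1 _ hx hv.choose_spec.2

namespace TGD

/-- The TGD obtained from `ρ` by substituting `σ x` for every variable `x`. -/
noncomputable def rename (σ : ℕ → ℕ) (ρ : TGD) : TGD :=
  ⟨ρ.body.image (Atom.map σ), ρ.head.image (Atom.map σ)⟩

/-- The substitution `σ` never identifies an existentially quantified variable of `ρ` with a
variable of the body. -/
def Separates (σ : ℕ → ℕ) (ρ : TGD) : Prop :=
  ∀ x ∈ occurring ρ.body, ∀ y ∈ occurring ρ.head, σ x = σ y → y ∈ occurring ρ.body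

variable {σ : ℕ → ℕ} {ρ : TGD}

theorem frontier_rename (hσ : Separates σ ρ) : (ρ.rename σ).frontier = σ '' ρ.frontier := by
  unfold frontier rename
  simp only [occurring_image_map]
  apply Set.Subset.antisymm
  · rintro v ⟨⟨x, hx, rfl⟩, y, hy, hxy⟩
    exact ⟨y, ⟨hσ x hx y hy hxy.symm, hy⟩, hxy⟩
  · exact Set.image_inter_subset _ _ _

theorem IsGuarded.rename (h : ρ.IsGuarded) (σ : ℕ → ℕ) : (ρ.rename σ).IsGuarded := by
  rcases h with h | ⟨a, ha, hsub⟩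
  · left; simp [TGD.rename, h]
  · refine Or.inr ⟨a.map σ, Finset.mem_image_of_mem _ ha, ?_⟩
    simp only [TGD.rename, occurring_image_map, Atom.terms_map]
    exact Set.image_mono hsub

theorem IsFrontierGuarded.rename (h : ρ.IsFrontierGuarded) (hσ : Separates σ ρ) :
    (ρ.rename σ).IsFrontierGuarded := by
  rcases h with h | ⟨a, ha, hsub⟩
  · left; simp [TGD.rename, h]
  · refine Or.inr ⟨a.map σ, Finset.mem_image_of_mem _ ha, ?_⟩
    rw [frontier_rename hσ, Atom.terms_map]
    exact Set.image_mono hsub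

theorem IsFrontierOne.rename (h : ρ.IsFrontierOne) (hσ : Separates σ ρ) :
    (ρ.rename σ).IsFrontierOne := by
  unfold IsFrontierOne
  rw [frontier_rename hσ]
  exact h.image σ

theorem Over.rename {S : Set RelSym} (h : ρ.Over S) (σ : ℕ → ℕ) : (ρ.rename σ).Over S := by
  constructor
  · intro b hb
    obtain ⟨a, ha, rfl⟩ := Finset.mem_image.1 hb
    exact h.1 a ha
  · intro b hb
    obtain ⟨a, ha, rfl⟩ := Finset.mem_image.1 hb
    exact h.2 a ha

theorem IsGuarded.isFrontierGuarded (h : ρ.IsGuarded) : ρ.IsFrontierGuarded :=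
  h.imp_right fun ⟨a, ha, hsub⟩ => ⟨a, ha, Set.inter_subset_left.trans hsub⟩

/-- The only frontier variable, if there is one, occurs in some body atom. -/
theorem IsFrontierOne.isFrontierGuarded (h : ρ.IsFrontierOne) : ρ.IsFrontierGuarded := by
  rcases ρ.frontier.eq_empty_or_nonempty with he | ⟨x, hx⟩
  · rcases ρ.body.eq_empty_or_nonempty with hb | ⟨a, ha⟩
    · exact Or.inl hb
    · exact Or.inr ⟨a, ha, by simp [he]⟩
  · obtain ⟨a, ha, hxa⟩ := hx.1
    exact Or.inr ⟨a, ha, fun y hy => h hx hy ▸ hxa⟩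

/-- In a frontier-guarded TGD the restriction of a match to the frontier is determined by a fact,
namely the image of the guard (or by nothing, if the body is empty). This bounds the number of
relevant matches in an instance by the number of its facts plus one. -/
theorem IsFrontierGuarded.exists_key (h : ρ.IsFrontierGuarded) :
    ∃ key : (ℕ → ℕ) → Option (Atom ℕ),
      (∀ (I : Inst) (m : ℕ → ℕ), (∀ a ∈ ρ.body, a.map m ∈ I) → key m ∈ Finset.insertNone I) ∧
      ∀ m m' : ℕ → ℕ, key m = key m' → ∀ x ∈ ρ.frontier, m x = m' x := by
  rcases h with h | ⟨a, ha, hsub⟩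
  · refine ⟨fun _ => none, fun I m _ => Finset.none_mem_insertNone, fun m m' _ x hx => ?_⟩
    obtain ⟨a, ha, -⟩ := hx.1
    simp [h] at ha
  · refine ⟨fun m => some (a.map m), fun I m hm => Finset.some_mem_insertNone.2 (hm a ha),
      fun m m' hmm x hx => ?_⟩
    exact Atom.eqOn_of_map_eq (Option.some.inj hmm) x (hsub hx)

/-! ### Few variables suffice for frontier-guarded TGDs -/

/-- A frontier-guarded TGD that holds in all of `P` and in none of `N` keeps this property under
some substitution with few values. Body variables are identified when the matches that
witness the failures in `N` do not tell them apart, and existentially quantified variables when the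
chosen head matches in `P`, one for every instance and every image of the guard, do not. -/
theorem exists_rename_lt {P N : Finset Inst} {B : ℕ} (hB : 0 < B) (hfg : ρ.IsFrontierGuarded)
    (hP : ∀ I ∈ P, Holds I ρ) (hN : ∀ J ∈ N, ¬ Holds J ρ)
    (hBP : ∀ I ∈ P, ∀ x ∈ occurring I, x < B) (hBN : ∀ J ∈ N, ∀ x ∈ occurring J, x < B) :
    ∃ σ : ℕ → ℕ, Separates σ ρ ∧
      (∀ x, σ x < 2 * (B ^ N.card * B ^ (∑ I ∈ P, (I.card + 1)))) ∧
      (∀ I ∈ P, Holds I (ρ.rename σ)) ∧ ∀ J ∈ N, ¬ Holds J (ρ.rename σ) := by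
  classical
  have : NeZero B := ⟨hB.ne'⟩
  obtain ⟨key, hkey, hkeyf⟩ := hfg.exists_key
  have hN' : ∀ J : Inst, ∃ h : ℕ → ℕ, J ∈ N → (∀ a ∈ ρ.body, a.map h ∈ J) ∧
      ¬ ∃ g : ℕ → ℕ, (∀ x ∈ ρ.frontier, g x = h x) ∧ ∀ a ∈ ρ.head, a.map g ∈ J := by
    intro J
    by_cases hJ : J ∈ N
    · have := hN J hJ
      unfold Holds at this
      push Not at this
      obtain ⟨h, h1, h2⟩ := this
      exact ⟨h, fun _ => ⟨h1, by push Not; exact h2⟩⟩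
    · exact ⟨id, fun h => absurd h hJ⟩
  choose hh hhN using hN'
  have hP' : ∀ (I : Inst) (f : Option (Atom ℕ)), ∃ g : ℕ → ℕ, I ∈ P → ∀ m : ℕ → ℕ,
      (∀ a ∈ ρ.body, a.map m ∈ I) → key m = f →
        (∀ x ∈ ρ.frontier, g x = m x) ∧ ∀ a ∈ ρ.head, a.map g ∈ I := by
    intro I f
    by_cases H : I ∈ P ∧ ∃ m : ℕ → ℕ, (∀ a ∈ ρ.body, a.map m ∈ I) ∧ key m = f
    · obtain ⟨hI, m, hm, rfl⟩ := H
      obtain ⟨g, hg1, hg2⟩ := hP I hI m hm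
      refine ⟨g, fun _ m' hm' hk => ⟨fun x hx => ?_, hg2⟩⟩
      rw [hg1 x hx, hkeyf m m' hk.symm x hx]
    · exact ⟨id, fun hI m hm hk => absurd ⟨hI, m, hm, hk⟩ H⟩
  choose gg hgg using hP'
  let T := Finset.sigma P fun I => Finset.insertNone I
  let K := Bool × (N → Fin B) × (T → Fin B)
  let code : ℕ → K := fun x => (decide (x ∈ occurring ρ.body), fun J => Fin.ofNat B (hh J.1 x),
    fun t => Fin.ofNat B (gg t.1.1 t.1.2 x))
  have hcard : Fintype.card K = 2 * (B ^ N.card * B ^ (∑ I ∈ P, (I.card + 1))) := by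
    simp [K, T, Finset.card_sigma]
  let e := Fintype.equivFin K
  let σ : ℕ → ℕ := fun x => e (code x)
  have hσ : ∀ x y, σ x = σ y → code x = code y := fun x y hxy => e.injective (Fin.ext hxy)
  have hmod : ∀ x y, x < B → y < B → Fin.ofNat B x = Fin.ofNat B y → x = y := by
    intro x y hx hy hxy
    have := congrArg Fin.val hxy
    simpa [Fin.ofNat, Nat.mod_eq_of_lt hx, Nat.mod_eq_of_lt hy] using this
  have hσb : ∀ x y, σ x = σ y → (x ∈ occurring ρ.body ↔ y ∈ occurring ρ.body) := by
    intro x y hxy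
    exact decide_eq_decide.1 (congrArg Prod.fst (hσ x y hxy))
  have hσN : ∀ J ∈ N, ∀ x ∈ occurring ρ.body, ∀ y ∈ occurring ρ.body, σ x = σ y →
      hh J x = hh J y := by
    intro J hJ x hx y hy hxy
    have h1 := (hhN J hJ).1
    exact hmod _ _ (hBN J hJ _ (mem_occurring_of_match h1 hx))
      (hBN J hJ _ (mem_occurring_of_match h1 hy))
      (congrFun (congrArg (fun k => k.2.1) (hσ x y hxy)) ⟨J, hJ⟩)
  have hσP : ∀ I ∈ P, ∀ m : ℕ → ℕ, (∀ a ∈ ρ.body, a.map m ∈ I) →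
      ∀ x ∈ occurring ρ.head, ∀ y ∈ occurring ρ.head, σ x = σ y →
      gg I (key m) x = gg I (key m) y := by
    intro I hI m hm x hx y hy hxy
    have h1 := (hgg I (key m) hI m hm rfl).2
    exact hmod _ _ (hBP I hI _ (mem_occurring_of_match h1 hx))
      (hBP I hI _ (mem_occurring_of_match h1 hy))
      (congrFun (congrArg (fun k => k.2.2) (hσ x y hxy))
        ⟨⟨I, key m⟩, Finset.mem_sigma.2 ⟨hI, hkey I m hm⟩⟩)
  have hsep : Separates σ ρ := fun x hx y _ hxy => (hσb x y hxy).1 hx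
  refine ⟨σ, hsep, fun x => hcard ▸ (e (code x)).2, fun I hI h hm => ?_, fun J hJ hJh => ?_⟩
  · have hm' : ∀ a ∈ ρ.body, a.map (h ∘ σ) ∈ I := fun a ha =>
      hm _ (Finset.mem_image_of_mem _ ha)
    obtain ⟨h1, h2⟩ := hgg I _ hI _ hm' rfl
    obtain ⟨g, hg⟩ := exists_factor (hσP I hI _ hm')
    refine ⟨g, fun v hv => ?_, fun b hb => ?_⟩
    · rw [frontier_rename hsep] at hv
      obtain ⟨x, hx, rfl⟩ := hv
      rw [hg x hx.2, h1 x hx]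
      rfl
    · obtain ⟨a, ha, rfl⟩ := Finset.mem_image.1 hb
      rw [Atom.map_map, Atom.map_congr (h := gg I (key (h ∘ σ)))]
      · exact h2 a ha
      · exact fun x hx => hg x ⟨a, ha, hx⟩
  · obtain ⟨h1, h2⟩ := hhN J hJ
    obtain ⟨h, hh'⟩ := exists_factor (hσN J hJ)
    obtain ⟨g, hg1, hg2⟩ := hJh h fun b hb => by
      obtain ⟨a, ha, rfl⟩ := Finset.mem_image.1 hb
      rw [Atom.map_map, Atom.map_congr (h := hh J)]
      · exact h1 a ha
      · exact fun x hx => hh' x ⟨a, ha, hx⟩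
    refine h2 ⟨g ∘ σ, fun x hx => ?_, fun a ha => hg2 _ (Finset.mem_image_of_mem _ ha)⟩
    rw [← hh' x hx.1]
    exact hg1 _ (by rw [frontier_rename hsep]; exact Set.mem_image_of_mem _ hx)

end TGD

/-! ### Size bounds -/

theorem Atom.arity_le_size (a : Atom ℕ) : a.rel.arity ≤ a.size := by
  unfold Atom.size
  have : ∑ _i : Fin a.rel.arity, 1 ≤ ∑ i, (1 + Nat.size (a.args i)) :=
    Finset.sum_le_sum fun i _ => by omega
  simp only [Finset.sum_const, Finset.card_univ, Fintype.card_fin, smul_eq_mul, mul_one] at this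
  omega

theorem Atom.size_name_le_size (a : Atom ℕ) : Nat.size a.rel.name ≤ a.size := by
  unfold Atom.size
  omega

theorem Atom.one_le_size (a : Atom ℕ) : 1 ≤ a.size := by
  unfold Atom.size
  omega

theorem Atom.lt_two_pow_size {a : Atom ℕ} {x : ℕ} (hx : x ∈ a.terms) : x < 2 ^ a.size := by
  obtain ⟨i, rfl⟩ := hx
  rw [← Nat.size_le]
  have := Finset.single_le_sum (f := fun i => 1 + Nat.size (a.args i)) (fun _ _ => Nat.zero_le _)
    (Finset.mem_univ i)
  unfold Atom.size
  omega

theorem Inst.size_le_of_mem {I : Inst} {a : Atom ℕ} (ha : a ∈ I) : a.size ≤ I.size := by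
  have := Finset.single_le_sum (f := Atom.size) (fun _ _ => Nat.zero_le _) ha
  unfold Inst.size
  omega

theorem Inst.card_lt_size (I : Inst) : I.card + 1 ≤ I.size := by
  have := Finset.card_nsmul_le_sum I (fun a => a.size) 1 fun a _ => a.one_le_size
  unfold Inst.size
  simp at this
  omega

/-- There are at most `s * (2 ^ M) ^ s` atoms with variables below `2 ^ M` over at most `s`
relation symbols of arity at most `s`. -/
theorem sum_size_le {S : Finset RelSym} {t : Finset (Atom ℕ)} {s M : ℕ} (hS : S.card ≤ s)
    (ht : ∀ a ∈ t, a.rel ∈ S) (har : ∀ R ∈ S, R.arity ≤ s) (hname : ∀ R ∈ S, Nat.size R.name ≤ s)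
    (hvar : ∀ x ∈ occurring t, x < 2 ^ M) :
    ∑ a ∈ t, a.size ≤ s * (2 ^ M) ^ s * (1 + s + s * (1 + M)) := by
  have hcard : t.card ≤ s * (2 ^ M) ^ s := by
    have hsub : t ⊆ (S.sigma fun R => Fintype.piFinset fun _ : Fin R.arity =>
        Finset.range (2 ^ M)).image fun p => (⟨p.1, p.2⟩ : Atom ℕ) := by
      intro a ha
      refine Finset.mem_image.2 ⟨⟨a.rel, a.args⟩, ?_, rfl⟩
      refine Finset.mem_sigma.2 ⟨ht a ha, Fintype.mem_piFinset.2 fun i => ?_⟩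
      exact Finset.mem_range.2 (hvar _ ⟨a, ha, ⟨i, rfl⟩⟩)
    refine (Finset.card_le_card hsub).trans (Finset.card_image_le.trans ?_)
    rw [Finset.card_sigma]
    calc _ ≤ S.card • (2 ^ M) ^ s := Finset.sum_le_card_nsmul _ _ _ fun R hR => by
            simp only [Fintype.card_piFinset, Finset.card_range, Finset.prod_const,
              Finset.card_univ, Fintype.card_fin]
            exact Nat.pow_le_pow_right (by positivity) (har R hR)
      _ ≤ s * (2 ^ M) ^ s := by rw [smul_eq_mul]; gcongr
  calc ∑ a ∈ t, a.size ≤ t.card • (1 + s + s * (1 + M)) :=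
        Finset.sum_le_card_nsmul _ _ _ fun a ha => by
          have h1 : ∑ i, (1 + Nat.size (a.args i)) ≤ a.rel.arity * (1 + M) := by
            have := Finset.sum_le_card_nsmul Finset.univ
              (fun i => 1 + Nat.size (a.args i)) (1 + M) fun i _ => by
                have := Nat.size_le.2 (hvar _ ⟨a, ha, ⟨i, rfl⟩⟩)
                omega
            simpa using this
          have h2 := Nat.mul_le_mul_right (1 + M) (har _ (ht a ha))
          have h3 := hname _ (ht a ha)
          unfold Atom.size
          omega
    _ ≤ _ := by rw [smul_eq_mul]; gcongr

namespace FittingInstance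

variable (E : FittingInstance)

theorem instSize_le_size {I : Inst} (hI : I ∈ E.pos ∨ I ∈ E.neg) : I.size ≤ E.size := by
  unfold size
  rcases hI with hI | hI
  · have := Finset.single_le_sum (f := Inst.size) (fun _ _ => Nat.zero_le _) hI
    omega
  · have := Finset.single_le_sum (f := Inst.size) (fun _ _ => Nat.zero_le _) hI
    omega

theorem card_neg_le_size : E.neg.card ≤ E.size := by
  have := Finset.card_nsmul_le_sum E.neg (fun I => I.size) 1 fun I _ => by
    have := I.card_lt_size
    omega
  unfold size
  simp at this
  omega

theorem sum_card_pos_le_size : ∑ I ∈ E.pos, (I.card + 1) ≤ E.size := by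
  have := Finset.sum_le_sum (s := E.pos) fun I _ => I.card_lt_size
  unfold size
  omega

theorem lt_two_pow_size {I : Inst} (hI : I ∈ E.pos ∨ I ∈ E.neg) {x : ℕ} (hx : x ∈ occurring I) :
    x < 2 ^ E.size := by
  obtain ⟨a, ha, hxa⟩ := hx
  exact (Atom.lt_two_pow_size hxa).trans_le (Nat.pow_le_pow_right (by norm_num)
    ((Inst.size_le_of_mem ha).trans (E.instSize_le_size hI)))

theorem exists_finset_schema : ∃ S : Finset RelSym, S.card ≤ E.size ∧
    (∀ R ∈ E.schema, R ∈ S) ∧ (∀ R ∈ S, R.arity ≤ E.size) ∧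
    ∀ R ∈ S, Nat.size R.name ≤ E.size := by
  have key : ∀ R ∈ ((E.pos ∪ E.neg).biUnion id).image Atom.rel,
      ∃ a : Atom ℕ, a.size ≤ E.size ∧ a.rel = R := by
    intro R hR
    obtain ⟨a, ha, rfl⟩ := Finset.mem_image.1 hR
    obtain ⟨I, hI, haI⟩ := Finset.mem_biUnion.1 ha
    exact ⟨a, (Inst.size_le_of_mem haI).trans (E.instSize_le_size (Finset.mem_union.1 hI)), rfl⟩
  refine ⟨((E.pos ∪ E.neg).biUnion id).image Atom.rel, ?_, ?_, ?_, ?_⟩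
  · have h1 := Finset.card_union_le (E.pos.biUnion id) (E.neg.biUnion id)
    have h2 : (E.pos.biUnion id).card ≤ ∑ I ∈ E.pos, I.card := Finset.card_biUnion_le
    have h3 : (E.neg.biUnion id).card ≤ ∑ I ∈ E.neg, I.card := Finset.card_biUnion_le
    have h4 : ∑ I ∈ E.pos, I.card ≤ ∑ I ∈ E.pos, I.size :=
      Finset.sum_le_sum fun I _ => by have := I.card_lt_size; omega
    have h5 : ∑ I ∈ E.neg, I.card ≤ ∑ I ∈ E.neg, I.size :=
      Finset.sum_le_sum fun I _ => by have := I.card_lt_size; omega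
    refine Finset.card_image_le.trans ?_
    rw [Finset.union_biUnion]
    unfold size
    omega
  · rintro R ⟨I, hI, a, ha, rfl⟩
    exact Finset.mem_image_of_mem _ (Finset.mem_biUnion.2 ⟨I, Finset.mem_union.2 hI, ha⟩)
  · intro R hR
    obtain ⟨a, ha, rfl⟩ := key R hR
    exact a.arity_le_size.trans ha
  · intro R hR
    obtain ⟨a, ha, rfl⟩ := key R hR
    exact a.size_name_le_size.trans ha

/-- If a frontier-guarded TGD over the schema separates the positive examples from some of the
negative ones, then so does a renaming of it of singly exponential size. -/
theorem exists_small_rename {ρ : TGD} (hfg : ρ.IsFrontierGuarded) (hS : ρ.Over E.schema)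
    (hP : ∀ I ∈ E.pos, TGD.Holds I ρ) {N : Finset Inst} (hNE : N ⊆ E.neg)
    (hN : ∀ J ∈ N, ¬ TGD.Holds J ρ) :
    ∃ σ : ℕ → ℕ, TGD.Separates σ ρ ∧ (∀ I ∈ E.pos, TGD.Holds I (ρ.rename σ)) ∧
      (∀ J ∈ N, ¬ TGD.Holds J (ρ.rename σ)) ∧
      (ρ.rename σ).size ≤ 2 ^ (4 + 2 * E.size + (2 * E.size ^ 2 + 1) * (E.size + 1)) := by
  obtain ⟨σ, hsep, hlt, hP', hN'⟩ := TGD.exists_rename_lt (B := 2 ^ E.size) (by positivity) hfg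
    hP hN (fun I hI x hx => E.lt_two_pow_size (Or.inl hI) hx)
    (fun I hI x hx => E.lt_two_pow_size (Or.inr (hNE hI)) hx)
  refine ⟨σ, hsep, hP', hN', ?_⟩
  obtain ⟨S, hScard, hSmem, hSar, hSname⟩ := E.exists_finset_schema
  set s := E.size with hs
  set M := 2 * s ^ 2 + 1 with hM
  have hvar : ∀ x, σ x < 2 ^ M := by
    intro x
    refine (hlt x).trans_le ?_
    have h1 : (2 ^ s) ^ N.card ≤ 2 ^ (s ^ 2) := by
      rw [← pow_mul, sq]
      exact Nat.pow_le_pow_right (by norm_num)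
        (Nat.mul_le_mul_left _ ((Finset.card_le_card hNE).trans E.card_neg_le_size))
    have h2 : (2 ^ s) ^ (∑ I ∈ E.pos, (I.card + 1)) ≤ 2 ^ (s ^ 2) := by
      rw [← pow_mul, sq]
      exact Nat.pow_le_pow_right (by norm_num) (Nat.mul_le_mul_left _ E.sum_card_pos_le_size)
    calc _ ≤ 2 * (2 ^ (s ^ 2) * 2 ^ (s ^ 2)) := by gcongr
      _ = 2 ^ M := by rw [hM]; ring
  have hvar' : ∀ (t : Finset (Atom ℕ)), ∀ x ∈ occurring (t.image (Atom.map σ)), x < 2 ^ M := by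
    intro t x hx
    rw [occurring_image_map] at hx
    obtain ⟨y, -, rfl⟩ := hx
    exact hvar y
  have hover := hS.rename σ
  have hb := sum_size_le hScard (fun a ha => hSmem _ (hover.1 a ha)) hSar hSname (hvar' ρ.body)
  have hh := sum_size_le hScard (fun a ha => hSmem _ (hover.2 a ha)) hSar hSname (hvar' ρ.head)
  have hmain : s * (2 ^ M) ^ s * (1 + s + s * (1 + M)) ≤ 2 ^ (2 + 2 * s + M * (s + 1)) := by
    have h1 : s ≤ 2 ^ s := Nat.lt_two_pow_self.le
    have h2 : M + 2 ≤ 2 ^ (M + 2) := Nat.lt_two_pow_self.le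
    have h3 : s + 1 ≤ 2 ^ s := Nat.lt_two_pow_self
    calc s * (2 ^ M) ^ s * (1 + s + s * (1 + M)) ≤ s * (2 ^ M) ^ s * ((s + 1) * (M + 2)) := by
          gcongr
          nlinarith
      _ ≤ 2 ^ s * (2 ^ M) ^ s * (2 ^ s * 2 ^ (M + 2)) := by gcongr
      _ = _ := by ring
  have hpos : 1 ≤ 2 ^ (2 + 2 * s + M * (s + 1)) := Nat.one_le_two_pow
  have hfin : 2 ^ (4 + 2 * s + M * (s + 1)) = 4 * 2 ^ (2 + 2 * s + M * (s + 1)) := by ring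
  rw [hfin]
  unfold TGD.size
  simp only [TGD.rename] at hb hh ⊢
  omega

end FittingInstance

open Polynomial in
/-- Every class of frontier-guarded TGDs that is closed under renaming has the single
exponential upper bounds. -/
theorem exists_upper_bound {L : TGD → Prop} (hfg : ∀ ρ, L ρ → ρ.IsFrontierGuarded)
    (hren : ∀ σ ρ, TGD.Separates σ ρ → L ρ → L (ρ.rename σ)) :
    ∃ q : Polynomial ℕ, ∀ E : FittingInstance,
      ((∃ ρ : TGD, L ρ ∧ E.FitTGD ρ) →
        ∃ ρ : TGD, L ρ ∧ E.FitTGD ρ ∧ ρ.size ≤ 2 ^ q.eval E.size) ∧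
      ((∃ O : Ontology, (∀ ρ ∈ O, L ρ) ∧ E.FitOntology O) →
        ∃ O : Ontology, (∀ ρ ∈ O, L ρ) ∧ E.FitOntology O ∧
          Ontology.size O ≤ 2 ^ q.eval E.size) := by
  refine ⟨5 + 3 * X + (2 * X ^ 2 + 1) * (X + 1), fun E => ?_⟩
  have hq : eval E.size (5 + 3 * X + (2 * X ^ 2 + 1) * (X + 1) : ℕ[X]) =
      E.size + (4 + 2 * E.size + (2 * E.size ^ 2 + 1) * (E.size + 1)) + 1 := by
    simp
    ring
  rw [hq]
  set e := 4 + 2 * E.size + (2 * E.size ^ 2 + 1) * (E.size + 1) with he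
  constructor
  · rintro ⟨ρ, hL, hS, hP, hN⟩
    obtain ⟨σ, hsep, hP', hN', hsize⟩ :=
      E.exists_small_rename (hfg ρ hL) hS hP (Finset.Subset.refl _) hN
    exact ⟨ρ.rename σ, hren σ ρ hsep hL, ⟨hS.rename σ, hP', hN'⟩,
      hsize.trans (Nat.pow_le_pow_right (by norm_num) (by omega))⟩
  · rintro ⟨O, hL, hS, hP, hN⟩
    -- one small TGD for every negative example
    have hJ : ∀ J : Inst, ∃ ρ : TGD, J ∈ E.neg → L ρ ∧ ρ.Over E.schema ∧
        (∀ I ∈ E.pos, TGD.Holds I ρ) ∧ ¬ TGD.Holds J ρ ∧ ρ.size ≤ 2 ^ e := by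
      intro J
      by_cases hJ : J ∈ E.neg
      · have := hN J hJ
        unfold Ontology.Holds at this
        push Not at this
        obtain ⟨ρ, hρ, hρJ⟩ := this
        obtain ⟨σ, hsep, hP', hN', hsize⟩ := E.exists_small_rename (N := {J})
          (hfg ρ (hL ρ hρ)) (hS ρ hρ) (fun I hI => hP I hI ρ hρ) (by simpa using hJ)
          (by simpa using hρJ)
        exact ⟨ρ.rename σ, fun _ => ⟨hren σ ρ hsep (hL ρ hρ), (hS ρ hρ).rename σ, hP',
          hN' J (by simp), hsize⟩⟩
      · exact ⟨⟨∅, ∅⟩, fun h => absurd h hJ⟩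
    choose τ hτ using hJ
    refine ⟨E.neg.image τ, ?_, ⟨?_, ?_, ?_⟩, ?_⟩
    · intro ρ hρ
      obtain ⟨J, hJ, rfl⟩ := Finset.mem_image.1 hρ
      exact (hτ J hJ).1
    · intro ρ hρ
      obtain ⟨J, hJ, rfl⟩ := Finset.mem_image.1 hρ
      exact (hτ J hJ).2.1
    · intro I hI ρ hρ
      obtain ⟨J, hJ, rfl⟩ := Finset.mem_image.1 hρ
      exact (hτ J hJ).2.2.1 I hI
    · intro J hJ hO
      exact (hτ J hJ).2.2.2.1 (hO _ (Finset.mem_image_of_mem _ hJ))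
    · have h1 := Finset.sum_le_card_nsmul (E.neg.image τ) (fun ρ => 1 + ρ.size) (1 + 2 ^ e)
        fun ρ hρ => by
          obtain ⟨J, hJ, rfl⟩ := Finset.mem_image.1 hρ
          have := (hτ J hJ).2.2.2.2
          omega
      rw [smul_eq_mul] at h1
      have h2 : (E.neg.image τ).card ≤ 2 ^ E.size :=
        (Finset.card_image_le.trans E.card_neg_le_size).trans Nat.lt_two_pow_self.le
      have h3 : 1 ≤ 2 ^ e := Nat.one_le_two_pow
      calc _ ≤ _ := h1
        _ ≤ 2 ^ E.size * (2 ^ e + 2 ^ e) := by gcongr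
        _ = _ := by ring

/-! ### Walks from a start point to an end point -/

/-- The unary relation symbol that marks start points. -/
def symStart : RelSym := ⟨0, 1, le_rfl⟩

/-- The unary relation symbol that marks end points. -/
def symEnd : RelSym := ⟨1, 1, le_rfl⟩

/-- The binary relation symbol for directed edges. -/
def symEdge : RelSym := ⟨2, 2, by norm_num⟩

/-- `x` is a start point. -/
def startAtom (x : ℕ) : Atom ℕ := ⟨symStart, fun _ => x⟩

/-- `x` is an end point. -/
def endAtom (x : ℕ) : Atom ℕ := ⟨symEnd, fun _ => x⟩

/-- There is an edge from `x` to `y`. -/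
def edgeAtom (x y : ℕ) : Atom ℕ := ⟨symEdge, ![x, y]⟩

theorem map_startAtom (h : ℕ → ℕ) (x : ℕ) : (startAtom x).map h = startAtom (h x) := rfl

theorem map_endAtom (h : ℕ → ℕ) (x : ℕ) : (endAtom x).map h = endAtom (h x) := rfl

theorem map_edgeAtom (h : ℕ → ℕ) (x y : ℕ) :
    (edgeAtom x y).map h = edgeAtom (h x) (h y) := by
  unfold Atom.map edgeAtom
  congr 1
  exact funext (Fin.forall_fin_two.2 ⟨rfl, rfl⟩)

@[simp] theorem startAtom_inj {x y : ℕ} : startAtom x = startAtom y ↔ x = y := by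
  refine ⟨fun h => ?_, fun h => h ▸ rfl⟩
  simp only [startAtom, Atom.mk.injEq, heq_eq_eq, true_and] at h
  exact congrFun h (0 : Fin 1)

@[simp] theorem endAtom_inj {x y : ℕ} : endAtom x = endAtom y ↔ x = y := by
  refine ⟨fun h => ?_, fun h => h ▸ rfl⟩
  simp only [endAtom, Atom.mk.injEq, heq_eq_eq, true_and] at h
  exact congrFun h (0 : Fin 1)

@[simp] theorem edgeAtom_inj {x y x' y' : ℕ} :
    edgeAtom x y = edgeAtom x' y' ↔ x = x' ∧ y = y' := by
  refine ⟨fun h => ?_, fun h => by rw [h.1, h.2]⟩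
  have h' : (![x, y] : Fin 2 → ℕ) = ![x', y'] := eq_of_heq (Atom.mk.inj h).2
  exact ⟨congrFun h' 0, congrFun h' 1⟩

@[simp] theorem startAtom_ne_endAtom (x y : ℕ) : startAtom x ≠ endAtom y := fun h => by
  simpa [startAtom, endAtom, symStart, symEnd] using congrArg (fun a => a.rel.name) h

@[simp] theorem startAtom_ne_edgeAtom (x y z : ℕ) : startAtom x ≠ edgeAtom y z := fun h => by
  simpa [startAtom, edgeAtom, symStart, symEdge] using congrArg (fun a => a.rel.name) h

@[simp] theorem endAtom_ne_edgeAtom (x y z : ℕ) : endAtom x ≠ edgeAtom y z := fun h => by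
  simpa [endAtom, edgeAtom, symEnd, symEdge] using congrArg (fun a => a.rel.name) h

@[simp] theorem endAtom_ne_startAtom (x y : ℕ) : endAtom x ≠ startAtom y :=
  (startAtom_ne_endAtom y x).symm

@[simp] theorem edgeAtom_ne_startAtom (x y z : ℕ) : edgeAtom y z ≠ startAtom x :=
  (startAtom_ne_edgeAtom x y z).symm

@[simp] theorem edgeAtom_ne_endAtom (x y z : ℕ) : edgeAtom y z ≠ endAtom x :=
  (endAtom_ne_edgeAtom x y z).symm

/-- The signature of all instances below. -/
def walkSchema : Set RelSym := {symStart, symEnd, symEdge}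

theorem atom_cases {a : Atom ℕ} (h : a.rel ∈ walkSchema) :
    (∃ x, a = startAtom x) ∨ (∃ x, a = endAtom x) ∨ ∃ x y, a = edgeAtom x y := by
  obtain ⟨R, args⟩ := a
  rcases h with h | h | h
  · obtain rfl : R = symStart := h
    refine Or.inl ⟨args (0 : Fin 1), ?_⟩
    unfold startAtom
    congr 1
    funext i
    exact congrArg args (Subsingleton.elim (α := Fin 1) _ _)
  · obtain rfl : R = symEnd := h
    refine Or.inr (Or.inl ⟨args (0 : Fin 1), ?_⟩)
    unfold endAtom
    congr 1
    funext i
    exact congrArg args (Subsingleton.elim (α := Fin 1) _ _)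
  · obtain rfl : R = symEdge := h
    refine Or.inr (Or.inr ⟨args (0 : Fin 2), args (1 : Fin 2), ?_⟩)
    unfold edgeAtom
    congr 1
    exact funext (Fin.forall_fin_two.2 ⟨rfl, rfl⟩)

/-- `w 0, …, w m` is a directed walk in `s` from a start point to an end point. -/
structure IsWalk (s : Finset (Atom ℕ)) (w : ℕ → ℕ) (m : ℕ) : Prop where
  start : startAtom (w 0) ∈ s
  edge : ∀ i < m, edgeAtom (w i) (w (i + 1)) ∈ s
  finish : endAtom (w m) ∈ s

variable {s t : Finset (Atom ℕ)} {w : ℕ → ℕ} {m : ℕ}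

theorem IsWalk.map (H : IsWalk s w m) {h : ℕ → ℕ} (hh : ∀ a ∈ s, a.map h ∈ t) :
    IsWalk t (h ∘ w) m where
  start := by simpa [map_startAtom] using hh _ H.start
  edge i hi := by simpa [map_edgeAtom] using hh _ (H.edge i hi)
  finish := by simpa [map_endAtom] using hh _ H.finish

theorem IsWalk.mono (H : IsWalk s w m) (hst : s ⊆ t) : IsWalk t w m :=
  ⟨hst H.start, fun i hi => hst (H.edge i hi), hst H.finish⟩

/-- Without walks, the set of points reachable from a start point contains no end point. -/
theorem exists_closed_of_no_walk (hs : ∀ w m, ¬ IsWalk s w m) :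
    ∃ C : Set ℕ, (∀ x, startAtom x ∈ s → x ∈ C) ∧
      (∀ x y, edgeAtom x y ∈ s → x ∈ C → y ∈ C) ∧ ∀ x ∈ C, endAtom x ∉ s := by
  refine ⟨{x | ∃ (w : ℕ → ℕ) (m : ℕ), startAtom (w 0) ∈ s ∧
    (∀ i < m, edgeAtom (w i) (w (i + 1)) ∈ s) ∧ w m = x}, ?_, ?_, ?_⟩
  · exact fun x hx => ⟨fun _ => x, 0, hx, by simp, rfl⟩
  · rintro x y hxy ⟨w, m, h0, h1, rfl⟩
    refine ⟨fun i => if i ≤ m then w i else y, m + 1, by simpa using h0, fun i hi => ?_, by simp⟩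
    rcases Nat.lt_succ_iff_lt_or_eq.1 hi with hi | rfl
    · simpa [hi.le, Nat.succ_le_of_lt hi] using h1 i hi
    · simpa using hxy
  · rintro x ⟨w, m, h0, h1, rfl⟩ hx
    exact hs w m ⟨h0, h1, hx⟩

/-- A shortest walk repeats no edge, so a lower bound on the length of all walks bounds the number
of atoms. -/
theorem le_sum_size_of_isWalk {d : ℕ} (hex : ∃ w m, IsWalk s w m)
    (hd : ∀ w m, IsWalk s w m → d ≤ m + 1) : d ≤ ∑ a ∈ s, a.size + 1 := by
  classical
  have hex' : ∃ m w, IsWalk s w m := let ⟨w, m, h⟩ := hex; ⟨m, w, h⟩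
  obtain ⟨m, ⟨w, hw⟩, hmin⟩ : ∃ m, (∃ w, IsWalk s w m) ∧ ∀ m' < m, ¬ ∃ w, IsWalk s w m' :=
    ⟨Nat.find hex', Nat.find_spec hex', fun _ => Nat.find_min hex'⟩
  have hinj : ∀ i j, i < j → j ≤ m → w i ≠ w j := by
    intro i j hij hjm heq
    -- cutting out the part between the two visits gives a shorter walk
    have hlt : m - (j - i) < m := by omega
    refine hmin _ hlt
      ⟨fun k => if k ≤ i then w k else w (k + (j - i)), by simpa using hw.start, ?_, ?_⟩
    · intro k hk
      by_cases h1 : k < i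
      · simpa [h1.le, Nat.succ_le_of_lt h1] using hw.edge k (by omega)
      · by_cases h2 : k = i
        · subst h2
          have := hw.edge j (by omega)
          have h3 : k + 1 + (j - k) = j + 1 := by omega
          simpa [heq, h3] using this
        · have h3 : ¬ k ≤ i := by omega
          have h4 : ¬ k + 1 ≤ i := by omega
          have h5 : k + 1 + (j - i) = k + (j - i) + 1 := by omega
          simpa [h3, h4, h5] using hw.edge (k + (j - i)) (by omega)
    · by_cases h1 : m - (j - i) ≤ i
      · have h2 : m - (j - i) = i := by omega
        have h3 : j = m := by omega
        subst h3
        simpa only [h2, le_refl, if_true, heq] using hw.finish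
      · have h2 : m - (j - i) + (j - i) = m := by omega
        simpa [h1, h2] using hw.finish
  have hsub : (Finset.range m).image (fun i => edgeAtom (w i) (w (i + 1))) ⊆ s := by
    intro a ha
    obtain ⟨i, hi, rfl⟩ := Finset.mem_image.1 ha
    exact hw.edge i (Finset.mem_range.1 hi)
  have hcard : ((Finset.range m).image (fun i => edgeAtom (w i) (w (i + 1)))).card = m := by
    rw [Finset.card_image_of_injOn, Finset.card_range]
    intro i hi j hj hij
    have h1 := (edgeAtom_inj.1 hij).1
    simp only [Finset.coe_range, Set.mem_Iio] at hi hj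
    rcases lt_trichotomy i j with h | h | h
    · exact absurd h1 (hinj i j h hj.le)
    · exact h
    · exact absurd h1.symm (hinj j i h hi.le)
  have h1 := Finset.card_le_card hsub
  have h2 := Finset.card_nsmul_le_sum s (fun a => a.size) 1 fun a _ => a.one_le_size
  have h3 := hd w m hw
  simp at h2
  omega

/-! ### Common multiples of an initial segment -/

/-- Every prime power that divides the central binomial coefficient is at most `2 * n`. -/
theorem centralBinom_dvd_of_forall_dvd {n M : ℕ} (hM : M ≠ 0)
    (h : ∀ k, 2 ≤ k → k ≤ 2 * n → k ∣ M) : n.centralBinom ∣ M := by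
  rw [← Nat.factorization_le_iff_dvd (Nat.centralBinom_ne_zero n) hM]
  intro p
  by_cases hp : p.Prime
  · by_cases h0 : n.centralBinom.factorization p = 0
    · simp [h0]
    · have hn : 0 < 2 * n := by
        rcases Nat.eq_zero_or_pos n with rfl | hn
        · simp at h0
        · omega
      refine (hp.pow_dvd_iff_le_factorization hM).1 (h _ ?_ ?_)
      · exact hp.two_le.trans (Nat.le_self_pow h0 p)
      · exact Nat.pow_factorization_choose_le hn
  · simp [Nat.factorization_eq_zero_of_not_prime _ hp]

theorem two_pow_le_centralBinom (n : ℕ) : 2 ^ n ≤ n.centralBinom := by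
  induction n with
  | zero => simp
  | succ n ih =>
    have h := Nat.succ_mul_centralBinom_succ n
    have h2 : (n + 1) * (2 * n.centralBinom) ≤ (n + 1) * (n + 1).centralBinom := by
      rw [h]
      nlinarith
    have h3 := Nat.le_of_mul_le_mul_left h2 (Nat.succ_pos n)
    rw [pow_succ]
    omega

/-- The common multiples of `2, …, 2 * n` are at least exponential in `n`. -/
theorem two_pow_le_of_forall_dvd {n M : ℕ} (hM : M ≠ 0)
    (h : ∀ k, 2 ≤ k → k ≤ 2 * n → k ∣ M) : 2 ^ n ≤ M :=
  (two_pow_le_centralBinom n).trans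
    (Nat.le_of_dvd (Nat.pos_of_ne_zero hM) (centralBinom_dvd_of_forall_dvd hM h))

/-! ### Paths, cycles and the trap -/

/-- The conjunction that describes a walk of length `m` with variables `0, …, m`. -/
noncomputable def pathAtoms (m : ℕ) : Finset (Atom ℕ) :=
  {startAtom 0, endAtom m} ∪ (Finset.range m).image fun i => edgeAtom i (i + 1)

/-- The directed cycle of length `k` on the values `2, …, k + 1`, with start point `2` and end
point `k + 1`. Its walks are those of a length congruent to `-1` modulo `k`. -/
noncomputable def cycleInst (k : ℕ) : Inst :=
  {startAtom 2, endAtom (k + 1)} ∪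
    (Finset.range k).image fun i => edgeAtom (i + 2) ((i + 1) % k + 2)

/-- The instance with the start point `0`, the end point `1` and all edges but the one from `0` to
`1`. It admits every set of atoms without walks. -/
noncomputable def trapInst : Inst :=
  {startAtom 0, endAtom 1, edgeAtom 0 0, edgeAtom 1 1, edgeAtom 1 0}

theorem isWalk_pathAtoms (m : ℕ) : IsWalk (pathAtoms m) id m where
  start := by simp [pathAtoms]
  edge i hi := by simpa [pathAtoms] using hi
  finish := by simp [pathAtoms]

theorem match_pathAtoms_iff {I : Inst} {h : ℕ → ℕ} :
    (∀ a ∈ pathAtoms m, a.map h ∈ I) ↔ IsWalk I h m := by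
  refine ⟨fun H => (isWalk_pathAtoms m).map H, fun H a ha => ?_⟩
  simp only [pathAtoms, Finset.mem_union, Finset.mem_insert, Finset.mem_singleton,
    Finset.mem_image, Finset.mem_range] at ha
  rcases ha with (rfl | rfl) | ⟨i, hi, rfl⟩
  · exact map_startAtom h 0 ▸ H.start
  · exact map_endAtom h m ▸ H.finish
  · exact map_edgeAtom h i (i + 1) ▸ H.edge i hi

theorem startAtom_mem_cycleInst {k x : ℕ} : startAtom x ∈ cycleInst k ↔ x = 2 := by
  simp [cycleInst]

theorem endAtom_mem_cycleInst {k x : ℕ} : endAtom x ∈ cycleInst k ↔ x = k + 1 := by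
  simp [cycleInst]

theorem edgeAtom_mem_cycleInst {k x y : ℕ} :
    edgeAtom x y ∈ cycleInst k ↔ ∃ i < k, i + 2 = x ∧ (i + 1) % k + 2 = y := by
  simp [cycleInst]

theorem startAtom_mem_trapInst {x : ℕ} : startAtom x ∈ trapInst ↔ x = 0 := by
  simp [trapInst]

theorem endAtom_mem_trapInst {x : ℕ} : endAtom x ∈ trapInst ↔ x = 1 := by
  simp [trapInst]

theorem edgeAtom_mem_trapInst {x y : ℕ} :
    edgeAtom x y ∈ trapInst ↔ x ≤ 1 ∧ y ≤ 1 ∧ (x = 0 → y = 0) := by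
  simp [trapInst]
  omega

theorem rel_mem_of_mem_cycleInst {k : ℕ} {a : Atom ℕ} (ha : a ∈ cycleInst k) :
    a.rel ∈ walkSchema := by
  simp only [cycleInst, Finset.mem_union, Finset.mem_insert, Finset.mem_singleton,
    Finset.mem_image, Finset.mem_range] at ha
  rcases ha with (rfl | rfl) | ⟨i, hi, rfl⟩ <;>
    simp [walkSchema, startAtom, endAtom, edgeAtom]

theorem rel_mem_of_mem_trapInst {a : Atom ℕ} (ha : a ∈ trapInst) : a.rel ∈ walkSchema := by
  simp only [trapInst, Finset.mem_insert, Finset.mem_singleton] at ha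
  rcases ha with rfl | rfl | rfl | rfl | rfl <;>
    simp [walkSchema, startAtom, endAtom, edgeAtom]

theorem le_one_of_mem_occurring_trapInst {x : ℕ} (hx : x ∈ occurring trapInst) : x ≤ 1 := by
  obtain ⟨a, ha, i, rfl⟩ := hx
  rcases atom_cases (rel_mem_of_mem_trapInst ha) with ⟨y, rfl⟩ | ⟨y, rfl⟩ | ⟨y, z, rfl⟩
  · have := startAtom_mem_trapInst.1 ha
    simp [startAtom, this]
  · have := endAtom_mem_trapInst.1 ha
    simp [endAtom, this]
  · have := edgeAtom_mem_trapInst.1 ha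
    exact Fin.forall_fin_two (p := fun i => (![y, z] : Fin 2 → ℕ) i ≤ 1).2 ⟨this.1, this.2.1⟩ i

theorem not_isWalk_trapInst : ¬ IsWalk trapInst w m := by
  intro H
  have h : ∀ i ≤ m, w i = 0 := by
    intro i
    induction i with
    | zero => exact fun _ => startAtom_mem_trapInst.1 H.start
    | succ i ih => exact fun hi => (edgeAtom_mem_trapInst.1 (H.edge i hi)).2.2 (ih (by omega))
  have h1 := endAtom_mem_trapInst.1 H.finish
  have h2 := h m le_rfl
  omega

/-- Every walk in the disjoint union of the trap and the `k`-cycle stays in the cycle, so `k`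
divides its length plus one. -/
theorem dvd_of_isWalk {k : ℕ} (H : IsWalk (trapInst ∪ cycleInst k) w m) : k ∣ m + 1 := by
  have hedge : ∀ i < m, (w i = 0 → w (i + 1) = 0) ∧
      ∀ c, w i = c % k + 2 → w (i + 1) = (c + 1) % k + 2 := by
    intro i hi
    rcases Finset.mem_union.1 (H.edge i hi) with h | h
    · have := edgeAtom_mem_trapInst.1 h
      exact ⟨this.2.2, fun c hc => by omega⟩
    · obtain ⟨j, hj, h1, h2⟩ := edgeAtom_mem_cycleInst.1 h
      refine ⟨fun h => by omega, fun c hc => ?_⟩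
      have : j = c % k := by omega
      rw [← h2, this, Nat.mod_add_mod]
  rcases Finset.mem_union.1 H.start with h | h
  · have h0 := startAtom_mem_trapInst.1 h
    have hall : ∀ i ≤ m, w i = 0 := by
      intro i
      induction i with
      | zero => exact fun _ => h0
      | succ i ih => exact fun hi => (hedge i hi).1 (ih (by omega))
    have h2 := hall m le_rfl
    rcases Finset.mem_union.1 H.finish with h | h
    · have := endAtom_mem_trapInst.1 h
      omega
    · have := endAtom_mem_cycleInst.1 h
      omega
  · have h0 := startAtom_mem_cycleInst.1 h
    have hall : ∀ i ≤ m, w i = i % k + 2 := by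
      intro i
      induction i with
      | zero => exact fun _ => by simpa using h0
      | succ i ih => exact fun hi => (hedge i hi).2 i (ih (by omega))
    have h2 := hall m le_rfl
    rcases Finset.mem_union.1 H.finish with h | h
    · have := endAtom_mem_trapInst.1 h
      omega
    · have := endAtom_mem_cycleInst.1 h
      have h3 : m % k + 1 = k := by omega
      have h4 := Nat.div_add_mod m k
      exact ⟨m / k + 1, by rw [Nat.mul_add]; omega⟩

theorem isWalk_cycleInst {k : ℕ} (hk : 0 < k) (hkm : k ∣ m + 1) :
    IsWalk (cycleInst k) (fun i => i % k + 2) m where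
  start := startAtom_mem_cycleInst.2 (by simp)
  edge i _ := edgeAtom_mem_cycleInst.2 ⟨i % k, Nat.mod_lt _ hk, rfl, by simp⟩
  finish := by
    refine endAtom_mem_cycleInst.2 ?_
    obtain ⟨c, hc⟩ := hkm
    obtain ⟨j, rfl⟩ : ∃ j, k = j + 1 := ⟨k - 1, by omega⟩
    obtain ⟨d, rfl⟩ : ∃ d, c = d + 1 := ⟨c - 1, by
      rcases c with _ | c
      · simp at hc
      · simp⟩
    have : m = j + (j + 1) * d := by
      rw [Nat.mul_add] at hc
      omega
    simp only [this, Nat.add_mul_mod_self_left]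
    rw [Nat.mod_eq_of_lt (by omega)]

theorem size_startAtom_le (x : ℕ) : (startAtom x).size ≤ 2 + x := by
  have := (Nat.size_le (m := x) (n := x)).2 Nat.lt_two_pow_self
  have h : (startAtom x).size = 1 + Nat.size 0 + ∑ _i : Fin 1, (1 + Nat.size x) := rfl
  simp at h
  omega

theorem size_endAtom_le (x : ℕ) : (endAtom x).size ≤ 3 + x := by
  have := (Nat.size_le (m := x) (n := x)).2 Nat.lt_two_pow_self
  have h : (endAtom x).size = 1 + Nat.size 1 + ∑ _i : Fin 1, (1 + Nat.size x) := rfl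
  simp at h
  omega

theorem size_edgeAtom_le (x y : ℕ) : (edgeAtom x y).size ≤ 5 + x + y := by
  have h1 := (Nat.size_le (m := x) (n := x)).2 Nat.lt_two_pow_self
  have h2 := (Nat.size_le (m := y) (n := y)).2 Nat.lt_two_pow_self
  have h3 : Nat.size 2 ≤ 2 := Nat.size_le.2 (by norm_num)
  have h4 : (edgeAtom x y).size =
      1 + Nat.size 2 + ∑ i : Fin 2, (1 + Nat.size ((![x, y] : Fin 2 → ℕ) i)) := rfl
  rw [h4, Fin.sum_univ_two]
  simp
  omega

theorem size_union_le (I J : Inst) : Inst.size (I ∪ J) ≤ Inst.size I + Inst.size J := by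
  have := Finset.sum_union_inter (s₁ := I) (s₂ := J) (f := fun a => a.size)
  unfold Inst.size
  omega

theorem size_cycleInst_le {k N : ℕ} (hk : k ≤ N) :
    Inst.size (cycleInst k) ≤ 9 + N + N * (8 + 2 * N) := by
  have h1 : ∑ a ∈ ({startAtom 2, endAtom (k + 1)} : Inst), a.size ≤ 8 + k := by
    rw [Finset.sum_pair (by simp)]
    have := size_startAtom_le 2
    have := size_endAtom_le (k + 1)
    omega
  have h2 : ∑ a ∈ (Finset.range k).image fun i => edgeAtom (i + 2) ((i + 1) % k + 2), a.size
      ≤ k * (8 + 2 * k) := by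
    refine (Finset.sum_le_card_nsmul _ _ (8 + 2 * k) fun a ha => ?_).trans ?_
    · obtain ⟨i, hi, rfl⟩ := Finset.mem_image.1 ha
      have hi := Finset.mem_range.1 hi
      have := size_edgeAtom_le (i + 2) ((i + 1) % k + 2)
      have := Nat.mod_lt (i + 1) (show 0 < k by omega)
      omega
    · rw [smul_eq_mul]
      gcongr
      exact Finset.card_image_le.trans (by simp)
  have h3 := Finset.sum_union_inter (s₁ := ({startAtom 2, endAtom (k + 1)} : Inst))
    (s₂ := (Finset.range k).image fun i => edgeAtom (i + 2) ((i + 1) % k + 2))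
    (f := fun a => a.size)
  have h4 : k * (8 + 2 * k) ≤ N * (8 + 2 * N) := by gcongr
  unfold Inst.size cycleInst
  omega

theorem sum_size_image_le {f : ℕ → Inst} {n B : ℕ} {K : Finset ℕ} (hK : K.card ≤ n)
    (hf : ∀ k ∈ K, Inst.size (f k) ≤ B) : ∑ I ∈ K.image f, Inst.size I ≤ n * B := by
  refine (Finset.sum_le_card_nsmul _ _ B fun I hI => ?_).trans ?_
  · obtain ⟨k, hk, rfl⟩ := Finset.mem_image.1 hI
    exact hf k hk
  · rw [smul_eq_mul]
    gcongr
    exact Finset.card_image_le.trans hK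

/-- The length of the paths in the fitting TGDs: it is congruent to `-1` modulo each of
`1, …, 2 * n`. -/
def pathLength (n : ℕ) : ℕ := (2 * n).factorial - 1

theorem dvd_pathLength_add_one {n k : ℕ} (hk : 0 < k) (hkn : k ≤ 2 * n) :
    k ∣ pathLength n + 1 := by
  unfold pathLength
  rw [Nat.sub_add_cancel (Nat.factorial_pos _)]
  exact Nat.dvd_factorial hk hkn

/-! ### The lower bound for arbitrary TGDs -/

/-- A TGD that holds in the disjoint unions of the trap with all short cycles, but not in the trap,
is exponentially large. If the head has a walk, then its length is restricted by all
cycles. Otherwise the part of the head that is matched into the `1`-cycle can be matched into the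
trap instead, by sending the variables that are reachable from a start point to `0` and all others
to `1`. -/
theorem TGD.two_pow_le_size_of_not_holds_trapInst {n : ℕ} (hn : 1 ≤ n) {ρ : TGD}
    (hP : ∀ k, 1 ≤ k → k ≤ 2 * n → TGD.Holds (trapInst ∪ cycleInst k) ρ)
    (hN : ¬ TGD.Holds trapInst ρ) : 2 ^ n ≤ ρ.size := by
  classical
  unfold TGD.Holds at hN
  push Not at hN
  obtain ⟨h, hbody, hhead⟩ := hN
  have hmatch : ∀ k, 1 ≤ k → k ≤ 2 * n → ∃ g : ℕ → ℕ, (∀ x ∈ ρ.frontier, g x = h x) ∧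
      ∀ a ∈ ρ.head, a.map g ∈ trapInst ∪ cycleInst k := fun k hk hkn =>
    hP k hk hkn h fun a ha => Finset.mem_union_left _ (hbody a ha)
  have hdvd : ∀ w m, IsWalk ρ.head w m → 2 ^ n ≤ m + 1 := by
    intro w m H
    refine two_pow_le_of_forall_dvd (Nat.succ_ne_zero m) fun k hk hkn => ?_
    obtain ⟨g, -, hg⟩ := hmatch k (by omega) hkn
    exact dvd_of_isWalk (H.map hg)
  by_cases hw : ∃ w m, IsWalk ρ.head w m
  · have := le_sum_size_of_isWalk hw hdvd
    unfold TGD.size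
    omega
  · push Not at hw
    obtain ⟨C, hC1, hC2, hC3⟩ := exists_closed_of_no_walk hw
    obtain ⟨g, hgf, hg⟩ := hmatch 1 le_rfl (by omega)
    obtain ⟨a, ha, hna⟩ := hhead (fun y => if g y ≤ 1 then g y else if y ∈ C then 0 else 1)
      fun x hx => by
        have h1 : g x ≤ 1 := by
          rw [hgf x hx]
          exact le_one_of_mem_occurring_trapInst (mem_occurring_of_match hbody hx.1)
        rw [if_pos h1, hgf x hx]
    refine absurd ?_ hna
    have hmem := hg a ha
    have hrel : (a.map g).rel ∈ walkSchema := (Finset.mem_union.1 hmem).elim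
      (fun h => rel_mem_of_mem_trapInst h) (fun h => rel_mem_of_mem_cycleInst h)
    rcases atom_cases (a := a) hrel with ⟨x, rfl⟩ | ⟨x, rfl⟩ | ⟨x, y, rfl⟩
    · rw [map_startAtom, Finset.mem_union, startAtom_mem_trapInst, startAtom_mem_cycleInst] at hmem
      rw [map_startAtom, startAtom_mem_trapInst]
      have := hC1 x ha
      rcases hmem with h | h <;> simp [h, this]
    · rw [map_endAtom, Finset.mem_union, endAtom_mem_trapInst, endAtom_mem_cycleInst] at hmem
      rw [map_endAtom, endAtom_mem_trapInst]
      have := fun hx => hC3 x hx ha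
      rcases hmem with h | h
      · simp [h]
      · simpa [h] using this
    · rw [map_edgeAtom, Finset.mem_union, edgeAtom_mem_trapInst, edgeAtom_mem_cycleInst] at hmem
      rw [map_edgeAtom, edgeAtom_mem_trapInst]
      rcases hmem with ⟨h1, h2, h3⟩ | ⟨i, -, h1, h2⟩
      · simpa [h1, h2] using h3
      · have h3 : ¬ g x ≤ 1 := by omega
        have h4 : ¬ g y ≤ 1 := by omega
        have h5 := hC2 x y ha
        simp only [h3, h4, if_false]
        split_ifs with h6 h7 <;> simp_all

/-- The positive examples are the disjoint unions of the trap with short cycles, the negative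
example is the trap alone. -/
noncomputable def trapFitting (n : ℕ) (hn : 1 ≤ n) : FittingInstance where
  pos := (Finset.Icc 1 (2 * n)).image fun k => trapInst ∪ cycleInst k
  neg := {trapInst}
  pos_nonempty := (Finset.nonempty_Icc.2 (by omega)).image _
  neg_nonempty := Finset.singleton_nonempty _

theorem two_pow_le_size_of_fitTGD_trapFitting {n : ℕ} (hn : 1 ≤ n) {ρ : TGD}
    (hρ : (trapFitting n hn).FitTGD ρ) : 2 ^ n ≤ ρ.size :=
  TGD.two_pow_le_size_of_not_holds_trapInst hn
    (fun _ hk hkn => hρ.2.1 _ (Finset.mem_image_of_mem _ (Finset.mem_Icc.2 ⟨hk, hkn⟩)))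
    (hρ.2.2 _ (Finset.mem_singleton_self _))

/-- The TGD with empty body that postulates a walk of length `m`. -/
noncomputable def walkTGD (m : ℕ) : TGD := ⟨∅, pathAtoms m⟩

theorem holds_walkTGD_iff {I : Inst} : TGD.Holds I (walkTGD m) ↔ ∃ w, IsWalk I w m := by
  constructor
  · intro H
    obtain ⟨g, -, hg⟩ := H id (by simp [walkTGD])
    exact ⟨g, match_pathAtoms_iff.1 hg⟩
  · rintro ⟨w, hw⟩ h -
    refine ⟨w, fun x hx => ?_, match_pathAtoms_iff.2 hw⟩
    obtain ⟨a, ha, -⟩ := hx.1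
    simp [walkTGD] at ha

theorem rel_mem_of_mem_pathAtoms {S : Set RelSym} (hS : walkSchema ⊆ S) {a : Atom ℕ}
    (ha : a ∈ pathAtoms m) : a.rel ∈ S := by
  refine hS ?_
  simp only [pathAtoms, Finset.mem_union, Finset.mem_insert, Finset.mem_singleton,
    Finset.mem_image, Finset.mem_range] at ha
  rcases ha with (rfl | rfl) | ⟨i, hi, rfl⟩ <;>
    simp [walkSchema, startAtom, endAtom, edgeAtom]

theorem fitTGD_walkTGD {n : ℕ} (hn : 1 ≤ n) :
    (trapFitting n hn).FitTGD (walkTGD (pathLength n)) := by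
  have hS : walkSchema ⊆ (trapFitting n hn).schema := by
    have hmem : trapInst ∈ (trapFitting n hn).pos ∨ trapInst ∈ (trapFitting n hn).neg :=
      Or.inr (Finset.mem_singleton_self _)
    rintro R (rfl | rfl | rfl)
    · exact ⟨_, hmem, startAtom 0, startAtom_mem_trapInst.2 rfl, rfl⟩
    · exact ⟨_, hmem, endAtom 1, endAtom_mem_trapInst.2 rfl, rfl⟩
    · exact ⟨_, hmem, edgeAtom 0 0, edgeAtom_mem_trapInst.2 (by simp), rfl⟩
  refine ⟨⟨fun a ha => by simp [walkTGD] at ha, fun a ha => rel_mem_of_mem_pathAtoms hS ha⟩,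
    fun I hI => ?_, fun J hJ => ?_⟩
  · obtain ⟨k, hk, rfl⟩ := Finset.mem_image.1 hI
    obtain ⟨hk1, hk2⟩ := Finset.mem_Icc.1 hk
    exact holds_walkTGD_iff.2
      ⟨_, (isWalk_cycleInst hk1 (dvd_pathLength_add_one hk1 hk2)).mono Finset.subset_union_right⟩
  · obtain rfl := Finset.mem_singleton.1 hJ
    rw [holds_walkTGD_iff]
    rintro ⟨w, hw⟩
    exact not_isWalk_trapInst hw

theorem isGuarded_walkTGD (m : ℕ) : (walkTGD m).IsGuarded := Or.inl rfl

theorem isFrontierOne_walkTGD (m : ℕ) : (walkTGD m).IsFrontierOne := by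
  rintro x ⟨⟨a, ha, -⟩, -⟩
  simp [walkTGD] at ha

open Polynomial in
theorem exists_lower_bound :
    ∃ p : Polynomial ℕ, ∀ n : ℕ, 1 ≤ n → ∃ E : FittingInstance,
      E.size ≤ p.eval n ∧
      (∃ ρ : TGD, ρ.IsGuarded ∧ ρ.IsFrontierOne ∧ E.FitTGD ρ) ∧
      (∀ ρ : TGD, E.FitTGD ρ → 2 ^ n ≤ ρ.size) ∧
      (∃ O : Ontology, (∀ ρ ∈ O, ρ.IsGuarded ∧ ρ.IsFrontierOne) ∧ E.FitOntology O) ∧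
      (∀ O : Ontology, E.FitOntology O → 2 ^ n ≤ Ontology.size O) := by
  set c := Inst.size trapInst with hc
  refine ⟨2 * X * (C c + (9 + 2 * X + 2 * X * (8 + 4 * X))) + 1 + C c,
    fun n hn => ⟨trapFitting n hn, ?_, ?_, ?_, ?_, ?_⟩⟩
  · have h1 := sum_size_image_le (f := fun k => trapInst ∪ cycleInst k) (n := 2 * n)
      (B := c + (9 + 2 * n + 2 * n * (8 + 2 * (2 * n)))) (K := Finset.Icc 1 (2 * n)) (by simp)
      fun k hk => (size_union_le _ _).trans
        (Nat.add_le_add_left (size_cycleInst_le (Finset.mem_Icc.1 hk).2) _)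
    have h2 : ∑ I ∈ (trapFitting n hn).neg, Inst.size I = c := by simp [trapFitting, hc]
    have h3 : (2 * X * (C c + (9 + 2 * X + 2 * X * (8 + 4 * X))) + 1 + C c : ℕ[X]).eval n =
        2 * n * (c + (9 + 2 * n + 2 * n * (8 + 2 * (2 * n)))) + 1 + c := by
      simp only [eval_add, eval_mul, eval_X, eval_C, eval_one, eval_ofNat]
      ring
    rw [h3]
    unfold FittingInstance.size
    rw [h2]
    exact Nat.add_le_add_right (Nat.add_le_add_right h1 _) _
  · exact ⟨_, isGuarded_walkTGD _, isFrontierOne_walkTGD _, fitTGD_walkTGD hn⟩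
  · exact fun ρ hρ => two_pow_le_size_of_fitTGD_trapFitting hn hρ
  · obtain ⟨h1, h2, h3⟩ := fitTGD_walkTGD hn
    refine ⟨{walkTGD (pathLength n)}, ?_, ?_, ?_, ?_⟩
    · simpa using ⟨isGuarded_walkTGD _, isFrontierOne_walkTGD _⟩
    · simpa [Ontology.Over] using h1
    · simpa [Ontology.Holds] using h2
    · simpa [Ontology.Holds] using h3
  · rintro O ⟨h1, h2, h3⟩
    -- the member that fails in the only negative example fits by itself
    have hO := h3 trapInst (Finset.mem_singleton_self _)
    unfold Ontology.Holds at hO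
    push Not at hO
    obtain ⟨ρ, hρ, hρN⟩ := hO
    have h4 := two_pow_le_size_of_fitTGD_trapFitting hn (ρ := ρ)
      ⟨h1 ρ hρ, fun I hI => h2 I hI ρ hρ, fun J hJ => by
        obtain rfl := Finset.mem_singleton.1 hJ
        exact hρN⟩
    have h5 := Finset.single_le_sum (f := fun ρ : TGD => 1 + ρ.size)
      (fun _ _ => Nat.zero_le _) hρ
    unfold Ontology.size
    omega

/-! ### The lower bound for full TGDs -/

/-- An instance without walks in which any atom missing from a given set of atoms without walks
can be falsified. The value `v` stands for a point with colour `v % 2` and tag `v / 2`. Start points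
have colour `0`, end points have colour `1`, and no edge leads from colour `0` to colour `1`. Apart
from this, only the following atoms are left out: edges from tag `1` to tag `2`, edges from tag `3`
to tag `3`, start points with tag `4`, and end points with tag `5`. -/
noncomputable def blockerInst : Inst :=
  ((Finset.range 12).filter fun v => v % 2 = 0 ∧ v / 2 ≠ 4).image startAtom ∪
  ((Finset.range 12).filter fun v => v % 2 = 1 ∧ v / 2 ≠ 5).image endAtom ∪
  ((Finset.range 12 ×ˢ Finset.range 12).filter fun p =>
    (p.1 % 2 = 0 → p.2 % 2 = 0) ∧ ¬ (p.1 / 2 = 1 ∧ p.2 / 2 = 2) ∧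
      ¬ (p.1 / 2 = 3 ∧ p.2 / 2 = 3)).image fun p => edgeAtom p.1 p.2

theorem startAtom_mem_blockerInst {v : ℕ} :
    startAtom v ∈ blockerInst ↔ v < 12 ∧ v % 2 = 0 ∧ v / 2 ≠ 4 := by
  simp [blockerInst]

theorem endAtom_mem_blockerInst {v : ℕ} :
    endAtom v ∈ blockerInst ↔ v < 12 ∧ v % 2 = 1 ∧ v / 2 ≠ 5 := by
  simp [blockerInst]

theorem edgeAtom_mem_blockerInst {v u : ℕ} :
    edgeAtom v u ∈ blockerInst ↔ (v < 12 ∧ u < 12) ∧ (v % 2 = 0 → u % 2 = 0) ∧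
      ¬ (v / 2 = 1 ∧ u / 2 = 2) ∧ ¬ (v / 2 = 3 ∧ u / 2 = 3) := by
  simp [blockerInst]

theorem rel_mem_of_mem_blockerInst {a : Atom ℕ} (ha : a ∈ blockerInst) : a.rel ∈ walkSchema := by
  simp only [blockerInst, Finset.mem_union, Finset.mem_image] at ha
  rcases ha with (⟨x, -, rfl⟩ | ⟨x, -, rfl⟩) | ⟨x, -, rfl⟩ <;>
    simp [walkSchema, startAtom, endAtom, edgeAtom]

theorem not_isWalk_blockerInst : ¬ IsWalk blockerInst w m := by
  intro H
  have h : ∀ i ≤ m, w i % 2 = 0 := by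
    intro i
    induction i with
    | zero => exact fun _ => (startAtom_mem_blockerInst.1 H.start).2.1
    | succ i ih => exact fun hi => (edgeAtom_mem_blockerInst.1 (H.edge i hi)).2.1 (ih (by omega))
  have h1 := (endAtom_mem_blockerInst.1 H.finish).2.1
  have h2 := h m le_rfl
  omega

/-- A set of atoms without walks can be matched into the blocker without matching a given further
atom. -/
theorem exists_match_blockerInst (hs : ∀ w m, ¬ IsWalk s w m) (hrel : ∀ a ∈ s, a.rel ∈ walkSchema)
    {b : Atom ℕ} (hb : b.rel ∈ walkSchema) (hbs : b ∉ s) :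
    ∃ h : ℕ → ℕ, (∀ a ∈ s, a.map h ∈ blockerInst) ∧ b.map h ∉ blockerInst := by
  classical
  obtain ⟨C, hC1, hC2, hC3⟩ := exists_closed_of_no_walk hs
  -- it is enough to choose tags: the colour `0` marks the points reachable from a start point
  have key : ∀ tag : ℕ → ℕ, (∀ x, tag x ≤ 5) → (∀ x, startAtom x ∈ s → tag x ≠ 4) →
      (∀ x, endAtom x ∈ s → tag x ≠ 5) →
      (∀ x y, edgeAtom x y ∈ s → ¬ (tag x = 1 ∧ tag y = 2) ∧ ¬ (tag x = 3 ∧ tag y = 3)) →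
      ∀ a ∈ s, a.map (fun x => 2 * tag x + if x ∈ C then 0 else 1) ∈ blockerInst := by
    intro tag h5 hstart hend hedge a ha
    rcases atom_cases (hrel a ha) with ⟨x, rfl⟩ | ⟨x, rfl⟩ | ⟨x, y, rfl⟩
    · rw [map_startAtom, startAtom_mem_blockerInst]
      have h1 := h5 x
      have h2 := hstart x ha
      simp only [hC1 x ha, if_true]
      omega
    · rw [map_endAtom, endAtom_mem_blockerInst]
      have h1 := h5 x
      have h2 := hend x ha
      have h3 : x ∉ C := fun h => hC3 x h ha
      simp only [h3, if_false]
      omega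
    · rw [map_edgeAtom, edgeAtom_mem_blockerInst]
      have h1 := h5 x
      have h2 := h5 y
      have h3 := hedge x y ha
      have h4 := hC2 x y ha
      by_cases hx : x ∈ C
      · simp only [hx, h4 hx, if_true]
        omega
      · by_cases hy : y ∈ C
        · simp only [hx, hy, if_true, if_false]
          omega
        · simp only [hx, hy, if_false]
          omega
  rcases atom_cases hb with ⟨z, rfl⟩ | ⟨z, rfl⟩ | ⟨z, z', rfl⟩
  · refine ⟨_, key (fun x => if x = z then 4 else 0) (fun x => by split_ifs <;> omega)
      (fun x hx => ?_) (fun x _ => by split_ifs <;> omega)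
      (fun x y _ => by split_ifs <;> simp), ?_⟩
    · have : x ≠ z := fun h => hbs (h ▸ hx)
      simp [this]
    · rw [map_startAtom, startAtom_mem_blockerInst]
      simp only [if_true]
      split_ifs <;> omega
  · refine ⟨_, key (fun x => if x = z then 5 else 0) (fun x => by split_ifs <;> omega)
      (fun x _ => by split_ifs <;> omega) (fun x hx => ?_)
      (fun x y _ => by split_ifs <;> simp), ?_⟩
    · have : x ≠ z := fun h => hbs (h ▸ hx)
      simp [this]
    · rw [map_endAtom, endAtom_mem_blockerInst]
      simp only [if_true]
      split_ifs <;> omega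
  · by_cases hzz : z = z'
    · subst hzz
      refine ⟨_, key (fun x => if x = z then 3 else 0) (fun x => by split_ifs <;> omega)
        (fun x _ => by split_ifs <;> omega) (fun x _ => by split_ifs <;> omega)
        (fun x y hxy => ?_), ?_⟩
      · have : ¬ (x = z ∧ y = z) := fun h => hbs (by rw [h.1, h.2] at hxy; exact hxy)
        split_ifs <;> simp_all
      · rw [map_edgeAtom, edgeAtom_mem_blockerInst]
        simp only [if_true]
        split_ifs <;> omega
    · refine ⟨_, key (fun x => if x = z then 1 else if x = z' then 2 else 0)
        (fun x => by split_ifs <;> omega) (fun x _ => by split_ifs <;> omega)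
        (fun x _ => by split_ifs <;> omega) (fun x y hxy => ?_), ?_⟩
      · have : ¬ (x = z ∧ y = z') := fun h => hbs (by rw [h.1, h.2] at hxy; exact hxy)
        split_ifs <;> simp_all
      · rw [map_edgeAtom, edgeAtom_mem_blockerInst]
        simp only [if_true, if_neg (Ne.symm hzz)]
        split_ifs <;> omega

/-- The positive example is the blocker, the negative examples are the short cycles. -/
noncomputable def blockerFitting (n : ℕ) (hn : 1 ≤ n) : FittingInstance where
  pos := {blockerInst}
  neg := (Finset.Icc 2 (2 * n)).image cycleInst
  pos_nonempty := Finset.singleton_nonempty _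
  neg_nonempty := (Finset.nonempty_Icc.2 (by omega)).image _

theorem schema_blockerFitting {n : ℕ} (hn : 1 ≤ n) : (blockerFitting n hn).schema = walkSchema := by
  apply Set.Subset.antisymm
  · rintro R ⟨I, hI, a, ha, rfl⟩
    rcases hI with hI | hI
    · obtain rfl := Finset.mem_singleton.1 hI
      exact rel_mem_of_mem_blockerInst ha
    · obtain ⟨k, -, rfl⟩ := Finset.mem_image.1 hI
      exact rel_mem_of_mem_cycleInst ha
  · have hmem : blockerInst ∈ (blockerFitting n hn).pos ∨ blockerInst ∈ (blockerFitting n hn).neg :=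
      Or.inl (Finset.mem_singleton_self _)
    rintro R (rfl | rfl | rfl)
    · exact ⟨_, hmem, startAtom 0, startAtom_mem_blockerInst.2 (by simp), rfl⟩
    · exact ⟨_, hmem, endAtom 1, endAtom_mem_blockerInst.2 (by simp), rfl⟩
    · exact ⟨_, hmem, edgeAtom 0 0, edgeAtom_mem_blockerInst.2 (by simp), rfl⟩

/-- If the body of a fitting full TGD has a walk, then its length is restricted by all cycles.
Otherwise the TGD would fail in the blocker, as its head has an atom outside of the body. -/
theorem two_pow_le_size_of_isFull {n : ℕ} (hn : 1 ≤ n) {ρ : TGD} (hfull : ρ.IsFull)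
    (hρ : (blockerFitting n hn).FitTGD ρ) : 2 ^ n ≤ ρ.size := by
  obtain ⟨hS, hP, hN⟩ := hρ
  rw [schema_blockerFitting] at hS
  have hmatch : ∀ k, 2 ≤ k → k ≤ 2 * n → ∃ h : ℕ → ℕ, (∀ a ∈ ρ.body, a.map h ∈ cycleInst k) ∧
      ∃ a ∈ ρ.head, a.map h ∉ cycleInst k := by
    intro k hk hkn
    have := hN _ (Finset.mem_image_of_mem _ (Finset.mem_Icc.2 ⟨hk, hkn⟩))
    unfold TGD.Holds at this
    push Not at this
    obtain ⟨h, h1, h2⟩ := this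
    exact ⟨h, h1, h2 h fun _ _ => rfl⟩
  have hdvd : ∀ w m, IsWalk ρ.body w m → 2 ^ n ≤ m + 1 := by
    intro w m H
    refine two_pow_le_of_forall_dvd (Nat.succ_ne_zero m) fun k hk hkn => ?_
    obtain ⟨h, hh, -⟩ := hmatch k hk hkn
    exact dvd_of_isWalk ((H.map hh).mono Finset.subset_union_right)
  by_cases hw : ∃ w m, IsWalk ρ.body w m
  · have := le_sum_size_of_isWalk hw hdvd
    unfold TGD.size
    omega
  · push Not at hw
    obtain ⟨h, hh, b, hb, hbh⟩ := hmatch 2 le_rfl (by omega)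
    obtain ⟨f, hf, hfb⟩ := exists_match_blockerInst hw hS.1 (hS.2 b hb) fun h => hbh (hh b h)
    obtain ⟨g, hg1, hg2⟩ := hP _ (Finset.mem_singleton_self _) f hf
    refine absurd (hg2 b hb) ?_
    rwa [Atom.map_congr (h := f)]
    exact fun x hx => hg1 x ⟨hfull ⟨b, hb, hx⟩, b, hb, hx⟩

/-- The full TGD saying that the first point of a walk of length `m` is an end point. -/
noncomputable def walkEndTGD (m : ℕ) : TGD := ⟨pathAtoms m, {endAtom 0}⟩

theorem isFull_walkEndTGD (m : ℕ) : (walkEndTGD m).IsFull := by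
  rintro x ⟨a, ha, i, rfl⟩
  obtain rfl := Finset.mem_singleton.1 ha
  exact ⟨startAtom 0, (isWalk_pathAtoms m).start, (0 : Fin 1), rfl⟩

theorem fitTGD_walkEndTGD {n : ℕ} (hn : 1 ≤ n) :
    (blockerFitting n hn).FitTGD (walkEndTGD (pathLength n)) := by
  refine ⟨⟨fun a ha => rel_mem_of_mem_pathAtoms (schema_blockerFitting hn).ge ha, fun a ha => ?_⟩,
    fun I hI => ?_, fun J hJ => ?_⟩
  · obtain rfl := Finset.mem_singleton.1 ha
    rw [schema_blockerFitting]
    simp [walkSchema, endAtom]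
  · obtain rfl := Finset.mem_singleton.1 hI
    exact fun h hh => absurd (match_pathAtoms_iff.1 hh) not_isWalk_blockerInst
  · obtain ⟨k, hk, rfl⟩ := Finset.mem_image.1 hJ
    obtain ⟨hk1, hk2⟩ := Finset.mem_Icc.1 hk
    intro H
    obtain ⟨g, hg1, hg2⟩ := H _ (match_pathAtoms_iff.2
      (isWalk_cycleInst (by omega) (dvd_pathLength_add_one (by omega) hk2)))
    have h0 : (0 : ℕ) ∈ (walkEndTGD (pathLength n)).frontier :=
      ⟨⟨startAtom 0, (isWalk_pathAtoms _).start, (0 : Fin 1), rfl⟩,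
        endAtom 0, Finset.mem_singleton_self _, (0 : Fin 1), rfl⟩
    have h1 := hg2 (endAtom 0) (Finset.mem_singleton_self _)
    rw [map_endAtom, endAtom_mem_cycleInst, hg1 0 h0] at h1
    -- the start point `2` is not the end point `k + 1` because `k ≠ 1`
    simp at h1
    omega

open Polynomial in
theorem exists_lower_bound_full :
    ∃ p : Polynomial ℕ, ∀ n : ℕ, 1 ≤ n → ∃ E : FittingInstance,
      E.size ≤ p.eval n ∧
      (∃ ρ : TGD, ρ.IsFull ∧ E.FitTGD ρ) ∧
      (∀ ρ : TGD, ρ.IsFull → E.FitTGD ρ → 2 ^ n ≤ ρ.size) := by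
  set c := Inst.size blockerInst with hc
  refine ⟨C c + 1 + 2 * X * (9 + 2 * X + 2 * X * (8 + 4 * X)),
    fun n hn => ⟨blockerFitting n hn, ?_, ⟨_, isFull_walkEndTGD _, fitTGD_walkEndTGD hn⟩,
      fun ρ hfull hρ => two_pow_le_size_of_isFull hn hfull hρ⟩⟩
  have h1 := sum_size_image_le (f := cycleInst) (n := 2 * n)
    (B := 9 + 2 * n + 2 * n * (8 + 2 * (2 * n))) (K := Finset.Icc 2 (2 * n)) (by simp)
    fun k hk => size_cycleInst_le (Finset.mem_Icc.1 hk).2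
  have h2 : ∑ I ∈ (blockerFitting n hn).pos, Inst.size I = c := by simp [blockerFitting, hc]
  have h3 : (C c + 1 + 2 * X * (9 + 2 * X + 2 * X * (8 + 4 * X)) : ℕ[X]).eval n =
      c + 1 + 2 * n * (9 + 2 * n + 2 * n * (8 + 2 * (2 * n))) := by
    simp only [eval_add, eval_mul, eval_X, eval_C, eval_one, eval_ofNat]
    ring
  rw [h3]
  unfold FittingInstance.size
  rw [h2]
  exact Nat.add_le_add_left h1 _

end TGDFitting

theorem mainTheorem12 :
    -- polynomial-size fitting instances with a fitting guarded and frontier-one TGD (ontology)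
    -- all of whose fitting TGDs (ontologies) have size at least `2 ^ n`
    (∃ p : Polynomial ℕ, ∀ n : ℕ, 1 ≤ n → ∃ E : FittingInstance,
      E.size ≤ p.eval n ∧
      (∃ ρ : TGD, ρ.IsGuarded ∧ ρ.IsFrontierOne ∧ E.FitTGD ρ) ∧
      (∀ ρ : TGD, E.FitTGD ρ → 2 ^ n ≤ ρ.size) ∧
      (∃ O : Ontology, (∀ ρ ∈ O, ρ.IsGuarded ∧ ρ.IsFrontierOne) ∧ E.FitOntology O) ∧
      (∀ O : Ontology, E.FitOntology O → 2 ^ n ≤ Ontology.size O)) ∧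
    -- tightness: single exponential upper bounds for guarded, frontier-guarded and
    -- frontier-one TGDs and ontologies
    (∀ L ∈ ({TGD.IsGuarded, TGD.IsFrontierGuarded, TGD.IsFrontierOne} : Set (TGD → Prop)),
      ∃ q : Polynomial ℕ, ∀ E : FittingInstance,
        ((∃ ρ : TGD, L ρ ∧ E.FitTGD ρ) →
          ∃ ρ : TGD, L ρ ∧ E.FitTGD ρ ∧ ρ.size ≤ 2 ^ q.eval E.size) ∧
        ((∃ O : Ontology, (∀ ρ ∈ O, L ρ) ∧ E.FitOntology O) →
          ∃ O : Ontology, (∀ ρ ∈ O, L ρ) ∧ E.FitOntology O ∧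
            Ontology.size O ≤ 2 ^ q.eval E.size)) ∧
    -- the lower bound for full TGDs
    (∃ p : Polynomial ℕ, ∀ n : ℕ, 1 ≤ n → ∃ E : FittingInstance,
      E.size ≤ p.eval n ∧
      (∃ ρ : TGD, ρ.IsFull ∧ E.FitTGD ρ) ∧
      (∀ ρ : TGD, ρ.IsFull → E.FitTGD ρ → 2 ^ n ≤ ρ.size)) := by
  refine ⟨exists_lower_bound, ?_, exists_lower_bound_full⟩
  rintro L (rfl | rfl | rfl)
  · exact exists_upper_bound (fun ρ h => h.isFrontierGuarded) fun σ ρ _ h => h.rename σ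
  · exact exists_upper_bound (fun ρ h => h) fun σ ρ hσ h => h.rename hσ
  · exact exists_upper_bound (fun ρ h => h.isFrontierGuarded) fun σ ρ hσ h => h.rename hσ
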